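/- **Theorem 6.1.** All graphs are finite, simple and undirected. Let $\Gamma$ be a connected graph with vertex set $V$ whose adjacency matrix $A(\Gamma)$ has exactly three distinct eigenvalues, and suppose that $\Gamma$ is triregular, i.e. exactly three distinct numbers occur as degrees of vertices of $\Gamma$. Then the coherent rank of $\Gamma$ is at least $14$. Here a *coherent algebra* on $V$ is a matrix algebra $\mathcal A \subseteq \operatorname{Mat}_V(\mathbb C)$ that contains the identity matrix $I$ and the all-ones matrix $J$ and is closed under transposition and under the entrywise product; the *coherent closure* $\mathcal W(\Gamma)$ is the smallest coherent algebra on $V$ that contains $A(\Gamma)$; and the *coherent rank* of $\Gamma$ is the rank of $\mathcal W(\Gamma)$, i.e. the number of matrices in its unique basis of pairwise disjoint $\{0,1\}$-matrices, which is the dimension of $\mathcal W(\Gamma)$ as a complex vector space. -/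

import Mathlib

open scoped Matrix

/-- A coherent algebra on a finite set `V`: a complex matrix algebra containing the identity
matrix (part of `Subalgebra`) and the all-ones matrix, and closed under transposition and under
the entrywise product. -/
structure IsCoherentAlgebra {V : Type*} [Fintype V] [DecidableEq V]
    (S : Subalgebra ℂ (Matrix V V ℂ)) : Prop where
  allOnes_mem : (Matrix.of fun _ _ : V => (1 : ℂ)) ∈ S
  transpose_mem : ∀ M ∈ S, Mᵀ ∈ S
  hadamard_mem : ∀ M ∈ S, ∀ N ∈ S, Matrix.hadamard M N ∈ S

namespace SimpleGraph

variable {V : Type*} [Fintype V] [DecidableEq V] (G : SimpleGraph V) [DecidableRel G.Adj]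

/-- The coherent closure of a graph: the intersection of all coherent algebras that contain its
adjacency matrix. It is the least such algebra, by the three lemmas that follow. -/
def coherentClosure : Subalgebra ℂ (Matrix V V ℂ) :=
  sInf {S | IsCoherentAlgebra S ∧ G.adjMatrix ℂ ∈ S}

theorem isCoherentAlgebra_coherentClosure : IsCoherentAlgebra G.coherentClosure where
  allOnes_mem := Algebra.mem_sInf.2 fun _ hS => hS.1.allOnes_mem
  transpose_mem M hM := Algebra.mem_sInf.2 fun S hS =>
    hS.1.transpose_mem M (Algebra.mem_sInf.1 hM S hS)
  hadamard_mem M hM N hN := Algebra.mem_sInf.2 fun S hS =>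
    hS.1.hadamard_mem M (Algebra.mem_sInf.1 hM S hS) N (Algebra.mem_sInf.1 hN S hS)

theorem adjMatrix_mem_coherentClosure : G.adjMatrix ℂ ∈ G.coherentClosure :=
  Algebra.mem_sInf.2 fun _ hS => hS.2

theorem coherentClosure_le {S : Subalgebra ℂ (Matrix V V ℂ)} (hS : IsCoherentAlgebra S)
    (hA : G.adjMatrix ℂ ∈ S) : G.coherentClosure ≤ S :=
  sInf_le ⟨hS, hA⟩

/-- The coherent rank of a graph: the dimension of its coherent closure, that is, the number of
matrices in any basis of it, in particular in its basis of `0`-`1` matrices (which are the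
adjacency matrices of the relations of the associated coherent configuration). -/
noncomputable def coherentRank : ℕ :=
  Module.finrank ℂ G.coherentClosure

theorem coherentRank_eq_card {ι : Type*} [Fintype ι] (b : Module.Basis ι ℂ G.coherentClosure) :
    G.coherentRank = Fintype.card ι :=
  Module.finrank_eq_card_basis b

/-- The set of distinct (real) eigenvalues of the adjacency matrix of a graph. -/
def distinctEigenvalues : Set ℝ :=
  {μ | Module.End.HasEigenvalue (Matrix.toLin' (G.adjMatrix ℝ)) μ}

/-- A graph is triregular if exactly three distinct numbers occur as degrees of its vertices. -/
def IsTriregular : Prop :=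
  (Set.range fun v : V => G.degree v).ncard = 3

end SimpleGraph

/-! Positions `(u, v)` that no matrix of the coherent closure separates form classes, and the rank
is at least the number of classes (`card_quotient_le`). Diagonal classes refine the degree
partition. If the refinement is proper, four inequivalent diagonal positions already give 4² = 16
classes.

Otherwise the degree partition is equitable. Perron–Frobenius theory and the three eigenvalues give
A² - sA + pI = ααᵀ with α > 0 (`Connected.exists_adjMatrix_quadratic`). The diagonal reads α² =
degree + p, so α is constant on each of the three cells and separates them. Summing over cells gives
equations between the cell sizes, the quotient matrix and α.

These equations prevent all pairs of distinct cells from being completely joined or non-adjacent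
(`exists_ne_zero_ne_cellCard`). If cells i and j are neither, the blocks ii, ij, ji, jj have at
least two classes each and the other five at least one, 13 in total. If there are exactly 13, the
third cell is a single vertex and cells i and j are each complete or empty, which `false_of_design`
excludes. -/

namespace SimpleGraph

/-! ### Perron–Frobenius theory and the quadratic equation of the adjacency matrix -/

section Spectral

variable {V : Type*} [Fintype V] [DecidableEq V] (G : SimpleGraph V) [DecidableRel G.Adj]

theorem eigenvalues_mem_distinctEigenvalues (hA : (G.adjMatrix ℝ).IsHermitian) (i : V) :
    hA.eigenvalues i ∈ G.distinctEigenvalues := by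
  refine Module.End.hasEigenvalue_of_hasEigenvector (x := ⇑(hA.eigenvectorBasis i)) ⟨?_, ?_⟩
  · rw [Module.End.mem_eigenspace_iff, Matrix.toLin'_apply]
    exact hA.mulVec_eigenvectorBasis i
  · intro h
    apply hA.eigenvectorBasis.toBasis.ne_zero i
    ext j
    simpa using congrFun h j

theorem adjMatrix_sub_mul_sub_mul_sub_eq_zero {a b c : ℝ}
    (h : G.distinctEigenvalues ⊆ {a, b, c}) :
    (G.adjMatrix ℝ - a • 1) * ((G.adjMatrix ℝ - b • 1) * (G.adjMatrix ℝ - c • 1)) = 0 := by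
  have hA : (G.adjMatrix ℝ).IsHermitian := by
    rw [Matrix.IsHermitian, Matrix.conjTranspose_eq_transpose_of_trivial, transpose_adjMatrix]
  have key : ∀ r : ℝ, G.adjMatrix ℝ - r • 1 =
      Unitary.conjStarAlgAut ℝ _ hA.eigenvectorUnitary
        (Matrix.diagonal fun i => hA.eigenvalues i - r) := by
    intro r
    have h1 : (Matrix.diagonal fun i => hA.eigenvalues i - r) =
        Matrix.diagonal hA.eigenvalues - r • (1 : Matrix V V ℝ) := by
      rw [← Matrix.diagonal_one, ← Matrix.diagonal_smul, Matrix.diagonal_sub]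
      simp
    rw [h1, map_sub, map_smul, map_one]
    congr 1
    exact hA.spectral_theorem
  rw [key a, key b, key c, ← map_mul, ← map_mul, Matrix.diagonal_mul_diagonal,
    Matrix.diagonal_mul_diagonal]
  convert map_zero (Unitary.conjStarAlgAut ℝ (Matrix V V ℝ) hA.eigenvectorUnitary)
  rw [Matrix.diagonal_eq_zero]
  funext i
  rcases h (G.eigenvalues_mem_distinctEigenvalues hA i) with h | h | h <;> simp [h]
  rw [Set.mem_singleton_iff.1 h]
  simp

theorem posSemidef_smul_one_sub_adjMatrix {a : ℝ} (h : ∀ r ∈ G.distinctEigenvalues, r ≤ a) :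
    (a • 1 - G.adjMatrix ℝ).PosSemidef := by
  have hA : (G.adjMatrix ℝ).IsHermitian := by
    rw [Matrix.IsHermitian, Matrix.conjTranspose_eq_transpose_of_trivial, transpose_adjMatrix]
  have key : a • 1 - G.adjMatrix ℝ =
      Unitary.conjStarAlgAut ℝ _ hA.eigenvectorUnitary
        (Matrix.diagonal fun i => a - hA.eigenvalues i) := by
    have h1 : (Matrix.diagonal fun i => a - hA.eigenvalues i) =
        a • (1 : Matrix V V ℝ) - Matrix.diagonal hA.eigenvalues := by
      rw [← Matrix.diagonal_one, ← Matrix.diagonal_smul, Matrix.diagonal_sub]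
      simp
    rw [h1, map_sub, map_smul, map_one]
    congr 1
    exact hA.spectral_theorem
  rw [key, Unitary.conjStarAlgAut_apply]
  refine Matrix.PosSemidef.mul_mul_conjTranspose_same ?_ _
  rw [Matrix.posSemidef_diagonal_iff]
  exact fun i => sub_nonneg.2 (h _ (G.eigenvalues_mem_distinctEigenvalues hA i))

variable {G}

omit [DecidableEq V] in
-- At a zero of y the nonnegative values on the neighbours sum to zero, so zeros spread along walks.
theorem Connected.eq_zero_of_nonneg_of_mulVec_eq (hconn : G.Connected) {a : ℝ} {y : V → ℝ}
    (hy : 0 ≤ y) (h : (G.adjMatrix ℝ).mulVec y = a • y) {v : V} (hv : y v = 0) : y = 0 := by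
  have step : ∀ u w, G.Adj u w → y u = 0 → y w = 0 := by
    intro u w huw hu
    have h1 := congrFun h u
    rw [adjMatrix_mulVec_apply, Pi.smul_apply, hu, smul_zero,
      Finset.sum_eq_zero_iff_of_nonneg fun i _ => hy i] at h1
    exact h1 w (by simpa using huw)
  funext w
  obtain ⟨p⟩ := hconn.preconnected v w
  induction p with
  | nil => exact hv
  | cons hadj _ ih => exact ih (step _ _ hadj hv)

/-- Passing from x to |x| keeps the norm and does not decrease the quadratic form of A. So |x| is a
null vector of the form of aI - A, and semidefiniteness puts it in the kernel. -/
theorem adjMatrix_mulVec_abs_eq (a : ℝ)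
    (hpsd : (a • 1 - G.adjMatrix ℝ).PosSemidef) {x : V → ℝ}
    (hx : (G.adjMatrix ℝ).mulVec x = a • x) :
    (G.adjMatrix ℝ).mulVec |x| = a • |x| := by
  have h0 : |x| ⬝ᵥ (a • 1 - G.adjMatrix ℝ).mulVec |x| ≤ 0 := by
    rw [Matrix.sub_mulVec, Matrix.smul_mulVec, Matrix.one_mulVec, dotProduct_sub, sub_nonpos]
    have h1 : |x| ⬝ᵥ a • |x| = x ⬝ᵥ a • x := by
      simp only [dotProduct, Pi.smul_apply, Pi.abs_apply, smul_eq_mul]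
      refine Finset.sum_congr rfl fun i _ => ?_
      rw [mul_left_comm, abs_mul_abs_self, mul_left_comm]
    rw [h1, ← hx]
    simp only [dotProduct, adjMatrix_mulVec_apply, Pi.abs_apply]
    refine Finset.sum_le_sum fun i _ => ?_
    rw [Finset.mul_sum, Finset.mul_sum]
    refine Finset.sum_le_sum fun j _ => ?_
    rw [← abs_mul]
    exact le_abs_self _
  have h1 := hpsd.dotProduct_mulVec_nonneg |x|
  rw [star_trivial] at h1
  have h2 := (hpsd.dotProduct_mulVec_zero_iff |x|).1 (by rw [star_trivial]; exact le_antisymm h0 h1)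
  rw [Matrix.sub_mulVec, Matrix.smul_mulVec, Matrix.one_mulVec, sub_eq_zero] at h2
  exact h2.symm

theorem Connected.exists_adjMatrix_quadratic (hconn : G.Connected)
    (heig : G.distinctEigenvalues.ncard = 3) :
    ∃ (s p : ℝ) (α : V → ℝ), (∀ v, 0 < α v) ∧
      G.adjMatrix ℝ * G.adjMatrix ℝ - s • G.adjMatrix ℝ + p • 1 = Matrix.vecMulVec α α := by
  classical
  -- Only the largest eigenvalue, a, is singled out; b and c enter symmetrically.
  obtain ⟨a, b, c, hset, hb, hc⟩ : ∃ a b c : ℝ, G.distinctEigenvalues = {a, b, c} ∧ b < a ∧ c < a := by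
    obtain ⟨x, y, z, hxy, hxz, hyz, h⟩ := Set.ncard_eq_three.1 heig
    rcases lt_or_gt_of_ne hxy with h1 | h1 <;> rcases lt_or_gt_of_ne hxz with h2 | h2 <;>
      rcases lt_or_gt_of_ne hyz with h3 | h3
    · exact ⟨z, x, y, by rw [h]; ext; simp; tauto, h2, h3⟩
    · exact ⟨y, x, z, by rw [h]; ext; simp; tauto, h1, h3⟩
    · linarith
    · exact ⟨y, x, z, by rw [h]; ext; simp; tauto, h1, h3⟩
    · exact ⟨z, x, y, by rw [h]; ext; simp; tauto, h2, h3⟩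
    · linarith
    · exact ⟨x, y, z, h, h1, h2⟩
    · exact ⟨x, y, z, h, h1, h2⟩
  have hpsd := G.posSemidef_smul_one_sub_adjMatrix (a := a) (by
    intro r hr
    rw [hset] at hr
    rcases hr with rfl | rfl | rfl <;> linarith)
  have hzero := G.adjMatrix_sub_mul_sub_mul_sub_eq_zero hset.le
  set A := G.adjMatrix ℝ with hAdef
  have hev : Module.End.HasEigenvalue (Matrix.toLin' A) a := by
    have : a ∈ G.distinctEigenvalues := by simp [hset]
    exact this
  obtain ⟨x, hx⟩ := hev.exists_hasEigenvector
  have hx1 : A.mulVec x = a • x := by simpa using hx.apply_eq_smul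
  have hvanish : ∀ z : V → ℝ, A.mulVec z = a • z → ∀ v, z v = 0 → z = 0 := by
    intro z hz v hv
    have := hconn.eq_zero_of_nonneg_of_mulVec_eq (abs_nonneg z)
      (adjMatrix_mulVec_abs_eq a hpsd hz) (v := v) (by simp [hv])
    simpa using this
  set w := |x| with hw
  have hwA : A.mulVec w = a • w := adjMatrix_mulVec_abs_eq a hpsd hx1
  have hwpos : ∀ v, 0 < w v := fun v =>
    lt_of_le_of_ne (abs_nonneg _) fun h => hx.2 (hvanish x hx1 v (by
      simpa [hw] using h.symm))
  obtain ⟨v₀⟩ := hconn.nonempty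
  -- The a-eigenspace is a line: subtracting the multiple of w that agrees with z at `v₀` leaves an
  -- eigenvector with a zero.
  have hprop : ∀ z : V → ℝ, A.mulVec z = a • z → ∀ v, z v = z v₀ / w v₀ * w v := by
    intro z hz v
    have := hvanish (z - (z v₀ / w v₀) • w) (by
      rw [Matrix.mulVec_sub, Matrix.mulVec_smul, hz, hwA, smul_sub, smul_comm]) v₀ (by
      have := (hwpos v₀).ne'
      simp [this])
    have := congrFun this v
    simpa [sub_eq_zero] using this
  set M := (A - b • 1) * (A - c • 1) with hM
  have hMt : Mᵀ = M := by
    have hAt : Aᵀ = A := G.transpose_adjMatrix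
    rw [hM, Matrix.transpose_mul, Matrix.transpose_sub, Matrix.transpose_sub, hAt]
    simp only [Matrix.transpose_smul, Matrix.transpose_one]
    simp only [sub_mul, mul_sub, smul_mul_assoc, mul_smul_comm, one_mul, mul_one]
    module
  -- As (A - a)M = 0, the columns of M are a-eigenvectors. Together with symmetry this makes M a
  -- multiple κ of wwᵀ, and κ > 0 because M has eigenvalue (a - b)(a - c) on w.
  have hcol : ∀ u v, M v u = M v₀ u / w v₀ * w v := by
    intro u
    refine hprop (fun v => M v u) ?_
    have : A * M = a • M := by
      rw [sub_mul, smul_mul_assoc, one_mul, sub_eq_zero] at hzero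
      exact hzero
    funext v
    exact congrFun (congrFun this v) u
  set κ := M v₀ v₀ / w v₀ / w v₀ with hκ
  have hMent : ∀ u v, M u v = κ * w u * w v := by
    intro u v
    have h1 : M v₀ v = M v v₀ := congrFun (congrFun hMt v) v₀
    have hne := (hwpos v₀).ne'
    rw [hcol v u, h1, hcol v₀ v, hκ]
    field_simp
  have hMw : M.mulVec w = ((a - b) * (a - c)) • w := by
    rw [hM, ← Matrix.mulVec_mulVec]
    simp only [Matrix.sub_mulVec, Matrix.smul_mulVec, Matrix.one_mulVec, hwA, ← sub_smul,
      Matrix.mulVec_smul, smul_smul]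
    ring_nf
  have hκpos : 0 < κ := by
    have h1 := congrFun hMw v₀
    simp only [Matrix.mulVec, dotProduct, hMent, Pi.smul_apply, smul_eq_mul] at h1
    have h2 : ∑ v, κ * w v₀ * w v * w v = κ * (w v₀ * ∑ v, w v * w v) := by
      rw [Finset.mul_sum, Finset.mul_sum]
      exact Finset.sum_congr rfl fun _ _ => by ring
    have h3 : 0 < w v₀ * ∑ v, w v * w v := mul_pos (hwpos _)
      (Finset.sum_pos (fun v _ => mul_pos (hwpos v) (hwpos v)) ⟨v₀, Finset.mem_univ _⟩)
    have h4 : 0 < (a - b) * (a - c) * w v₀ :=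
      mul_pos (mul_pos (sub_pos.2 hb) (sub_pos.2 hc)) (hwpos _)
    rw [h2] at h1
    exact pos_of_mul_pos_left (h1 ▸ h4) h3.le
  refine ⟨b + c, b * c, fun v => √κ * w v, fun v => mul_pos (Real.sqrt_pos.2 hκpos) (hwpos v), ?_⟩
  have hexp : A * A - (b + c) • A + (b * c) • 1 = M := by
    rw [hM]
    simp only [sub_mul, mul_sub, smul_mul_assoc, mul_smul_comm, one_mul, mul_one, add_smul,
      mul_smul]
    module
  rw [hexp]
  ext u v
  rw [hMent, Matrix.vecMulVec_apply]
  calc κ * w u * w v = (√κ * √κ) * w u * w v := by rw [Real.mul_self_sqrt hκpos.le]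
    _ = _ := by ring

end Spectral

end SimpleGraph

/-! ### Classes of positions in a coherent algebra -/

section EntryClasses

variable {V : Type*} [Fintype V] [DecidableEq V]

/-- Two positions are equivalent if every matrix of the algebra has equal entries there. For a
coherent algebra the classes are the supports of its basis of `0`-`1` matrices. -/
def Subalgebra.entrySetoid (S : Subalgebra ℂ (Matrix V V ℂ)) : Setoid (V × V) where
  r x y := ∀ M ∈ S, M x.1 x.2 = M y.1 y.2
  iseqv := ⟨fun _ _ _ => rfl, fun h M hM => (h M hM).symm,
    fun h k M hM => (h M hM).trans (k M hM)⟩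

/-- The class of a position under `Subalgebra.entrySetoid`. -/
def Subalgebra.colour (S : Subalgebra ℂ (Matrix V V ℂ)) (u v : V) : Quotient S.entrySetoid :=
  Quotient.mk _ (u, v)

namespace IsCoherentAlgebra

variable {S : Subalgebra ℂ (Matrix V V ℂ)}

theorem colour_eq_iff {u v u' v' : V} :
    S.colour u v = S.colour u' v' ↔ ∀ M ∈ S, M u v = M u' v' :=
  Quotient.eq

/-- Evaluation at a position is a character of the entrywise multiplicative monoid of the algebra,
and distinct classes give distinct characters. Dedekind's independence of characters makes these
evaluations independent in the dual space. -/
theorem card_quotient_le (hS : IsCoherentAlgebra S) :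
    Nat.card (Quotient S.entrySetoid) ≤ Module.finrank ℂ S := by
  classical
  let H : Submonoid (V × V → ℂ) :=
    { carrier := {f | Matrix.of (fun u v => f (u, v)) ∈ S}
      one_mem' := hS.allOnes_mem
      mul_mem' := fun hf hg => hS.hadamard_mem _ hf _ hg }
  let ev : Quotient S.entrySetoid → (H →* ℂ) :=
    Quotient.lift (fun x => (Pi.evalMonoidHom (fun _ : V × V => ℂ) x).comp H.subtype)
      fun x y hxy => by
        ext f
        exact hxy _ f.2
  have hev : Function.Injective ev := by
    rintro ⟨x⟩ ⟨y⟩ hxy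
    refine Quotient.sound fun M hM => ?_
    exact DFunLike.congr_fun hxy (⟨fun z => M z.1 z.2, hM⟩ : H)
  let φ : Module.Dual ℂ S →ₗ[ℂ] (H → ℂ) :=
    { toFun := fun ψ f => ψ ⟨_, f.2⟩
      map_add' := fun _ _ => rfl
      map_smul' := fun _ _ => rfl }
  let evS : Quotient S.entrySetoid → Module.Dual ℂ S :=
    Quotient.lift (fun x => (Matrix.entryLinearMap ℂ ℂ x.1 x.2).comp S.toSubmodule.subtype)
      fun x y hxy => by
        ext M
        exact hxy _ M.2
  have hli : LinearIndependent ℂ evS := by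
    refine LinearIndependent.of_comp φ ?_
    have hcomp : φ ∘ evS = (fun f : H →* ℂ => (f : H → ℂ)) ∘ ev := by
      funext q
      induction q using Quotient.inductionOn
      rfl
    rw [hcomp]
    exact (linearIndependent_monoidHom H ℂ).comp ev hev
  have := Fintype.ofFinite (Quotient S.entrySetoid)
  rw [Nat.card_eq_fintype_card, ← Subspace.dual_finrank_eq]
  exact hli.fintype_card_le_finrank

theorem colour_diag_left (hS : IsCoherentAlgebra S) {u v u' v' : V}
    (h : S.colour u v = S.colour u' v') : S.colour u u = S.colour u' u' := by
  rw [colour_eq_iff] at h ⊢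
  intro M hM
  -- The (u, v) entry of (M ∘ I)J is M u u.
  simpa [Matrix.mul_apply, Matrix.hadamard, Matrix.one_apply] using
    h _ (S.mul_mem (hS.hadamard_mem M hM 1 S.one_mem) hS.allOnes_mem)

theorem colour_swap (hS : IsCoherentAlgebra S) {u v u' v' : V}
    (h : S.colour u v = S.colour u' v') : S.colour v u = S.colour v' u' := by
  rw [colour_eq_iff] at h ⊢
  intro M hM
  exact h _ (hS.transpose_mem M hM)

theorem colour_diag_right (hS : IsCoherentAlgebra S) {u v u' v' : V}
    (h : S.colour u v = S.colour u' v') : S.colour v v = S.colour v' v' :=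
  hS.colour_diag_left (hS.colour_swap h)

theorem eq_iff_of_colour_eq {u v u' v' : V}
    (h : S.colour u v = S.colour u' v') : u = v ↔ u' = v' := by
  rw [colour_eq_iff] at h
  have h0 := h 1 S.one_mem
  simp only [Matrix.one_apply] at h0
  by_cases h1 : u = v <;> by_cases h2 : u' = v' <;> simp [h1, h2] at h0 ⊢

/-- Pairwise inequivalent diagonal positions span inequivalent positions. -/
theorem card_sq_le {ι : Type*} [Fintype ι] (hS : IsCoherentAlgebra S) (f : ι → V)
    (hf : ∀ i j, S.colour (f i) (f i) = S.colour (f j) (f j) → i = j) :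
    Fintype.card ι ^ 2 ≤ Nat.card (Quotient S.entrySetoid) := by
  have : Function.Injective fun x : ι × ι => S.colour (f x.1) (f x.2) := fun x y h =>
    Prod.ext (hf _ _ (hS.colour_diag_left h)) (hf _ _ (hS.colour_diag_right h))
  have := Nat.card_le_card_of_injective _ this
  rwa [Nat.card_eq_fintype_card, Fintype.card_prod, ← sq] at this

end IsCoherentAlgebra

namespace SimpleGraph

variable {G : SimpleGraph V} [DecidableRel G.Adj] {S : Subalgebra ℂ (Matrix V V ℂ)}

theorem adj_iff_of_colour_eq (hA : G.adjMatrix ℂ ∈ S) {u v u' v' : V}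
    (h : S.colour u v = S.colour u' v') : G.Adj u v ↔ G.Adj u' v' := by
  rw [IsCoherentAlgebra.colour_eq_iff] at h
  have h0 := h _ hA
  by_cases h1 : G.Adj u v <;> by_cases h2 : G.Adj u' v' <;> simp [h1, h2] at h0 ⊢

theorem diagonal_degree_mem (hS : IsCoherentAlgebra S) (hA : G.adjMatrix ℂ ∈ S) :
    Matrix.diagonal (fun v => (G.degree v : ℂ)) ∈ S := by
  convert hS.hadamard_mem _ (S.mul_mem hA hS.allOnes_mem) 1 S.one_mem using 1
  ext u v
  by_cases h : u = v
  · subst h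
    simp [Matrix.hadamard, adjMatrix_mul_apply]
  · simp [Matrix.hadamard, h]

theorem degree_eq_of_colour_eq (hS : IsCoherentAlgebra S) (hA : G.adjMatrix ℂ ∈ S) {u v : V}
    (h : S.colour u u = S.colour v v) : G.degree u = G.degree v := by
  rw [IsCoherentAlgebra.colour_eq_iff] at h
  simpa using h _ (diagonal_degree_mem hS hA)

/-- A polynomial in the diagonal degree matrix gives the indicator D of degree d, and the diagonal
of ADJ counts neighbours of degree d. This makes the degree partition equitable once its cells are
single diagonal classes. -/
theorem card_neighbors_of_degree_eq_of_colour_eq (hS : IsCoherentAlgebra S)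
    (hA : G.adjMatrix ℂ ∈ S) (d : ℕ) {u v : V} (h : S.colour u u = S.colour v v) :
    (Finset.univ.filter fun w => G.Adj u w ∧ G.degree w = d).card =
      (Finset.univ.filter fun w => G.Adj v w ∧ G.degree w = d).card := by
  rw [IsCoherentAlgebra.colour_eq_iff] at h
  obtain ⟨P, hP⟩ : ∃ P : Polynomial ℂ, ∀ w,
      P.eval (G.degree w : ℂ) = if G.degree w = d then 1 else 0 := by
    refine ⟨Lagrange.interpolate (Finset.univ.image fun w => G.degree w) (fun n => (n : ℂ))
      (fun n => if n = d then 1 else 0), fun w => ?_⟩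
    exact Lagrange.eval_interpolate_at_node (v := fun n : ℕ => (n : ℂ)) _
      (Nat.cast_injective.injOn) (Finset.mem_image_of_mem _ (Finset.mem_univ w))
  have hD : Matrix.diagonal (fun w => if G.degree w = d then (1 : ℂ) else 0) ∈ S := by
    have h1 := Algebra.adjoin_le (Set.singleton_subset_iff.2 (diagonal_degree_mem hS hA))
      (Polynomial.aeval_mem_adjoin_singleton ℂ (p := P) _)
    convert h1 using 1
    rw [← Matrix.diagonalAlgHom_apply ℂ (fun v => (G.degree v : ℂ)),
      Polynomial.aeval_algHom_apply, Matrix.diagonalAlgHom_apply]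
    congr 1
    funext w
    rw [← hP w]
    simp [Polynomial.aeval_fn_apply]
  have key := h _ (S.mul_mem (S.mul_mem hA hD) hS.allOnes_mem)
  have hent : ∀ x : V, (G.adjMatrix ℂ *
      Matrix.diagonal (fun w => if G.degree w = d then (1 : ℂ) else 0) *
      Matrix.of fun _ _ : V => (1 : ℂ)) x x =
        ((Finset.univ.filter fun w => G.Adj x w ∧ G.degree w = d).card : ℂ) := by
    intro x
    rw [Finset.card_filter, Matrix.mul_apply]
    simp only [Matrix.mul_diagonal, Matrix.of_apply, adjMatrix_apply, mul_one]
    push_cast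
    refine Finset.sum_congr rfl fun w _ => ?_
    by_cases h1 : G.Adj x w <;> by_cases h2 : G.degree w = d <;> simp [h1, h2]
  rw [hent, hent] at key
  exact_mod_cast key

end SimpleGraph

end EntryClasses

namespace SimpleGraph

/-! ### Equitable partitions and the quadratic equation -/

section Equitable

variable {V : Type*} [Fintype V] (G : SimpleGraph V) [DecidableRel G.Adj]

/-- The partition of the vertices into the fibres of `t` is equitable with quotient `k`: a vertex
in the cell `i` has `k i j` neighbours in the cell `j`. -/
def IsEquitable {ι : Type*} [DecidableEq ι] (t : V → ι) (k : ι → ι → ℕ) : Prop :=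
  ∀ u j, (Finset.univ.filter fun w => G.Adj u w ∧ t w = j).card = k (t u) j

/-- The size of a fibre. -/
def cellCard {ι : Type*} [DecidableEq ι] (t : V → ι) (i : ι) : ℕ :=
  (Finset.univ.filter fun w => t w = i).card

variable {G} {ι : Type*} [DecidableEq ι] {t : V → ι} {k : ι → ι → ℕ}

namespace IsEquitable

theorem sum_adj (h : G.IsEquitable t k) (u : V) (j : ι) :
    ∑ w, (if t w = j then G.adjMatrix ℝ u w else 0) = k (t u) j := by
  rw [← h u j, Finset.card_filter]
  push_cast
  refine Finset.sum_congr rfl fun w _ => ?_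
  by_cases h1 : G.Adj u w <;> by_cases h2 : t w = j <;> simp [h1, h2]

theorem sum_adj_mul [Fintype ι] (h : G.IsEquitable t k) (u : V) (f : ι → ℝ) :
    ∑ w, G.adjMatrix ℝ u w * f (t w) = ∑ j, k (t u) j * f j := by
  simp_rw [← h.sum_adj, Finset.sum_mul]
  rw [Finset.sum_comm]
  refine Finset.sum_congr rfl fun w _ => ?_
  simp [ite_mul]

/-- Both sides count the edges between the two cells. -/
theorem mul_comm_card (h : G.IsEquitable t k) (i j : ι) :
    cellCard t i * k i j = cellCard t j * k j i := by
  have h1 : ∀ a b, (cellCard t a * k a b : ℝ) =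
      ∑ u, ∑ w, if t u = a ∧ t w = b then G.adjMatrix ℝ u w else 0 := by
    intro a b
    rw [cellCard, Finset.card_filter]
    push_cast
    rw [Finset.sum_mul]
    refine Finset.sum_congr rfl fun u _ => ?_
    by_cases hu : t u = a
    · subst hu
      simp [← h.sum_adj u b]
    · simp [hu]
  have h2 := h1 i j
  rw [Finset.sum_comm] at h2
  have h3 : (cellCard t i * k i j : ℝ) = cellCard t j * k j i := by
    rw [h2, h1 j i]
    refine Finset.sum_congr rfl fun u _ => Finset.sum_congr rfl fun w _ => ?_
    simp only [adjMatrix_apply, G.adj_comm, and_comm]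
  exact_mod_cast h3

theorem le_cellCard (h : G.IsEquitable t k) (u : V) (j : ι) : k (t u) j ≤ cellCard t j := by
  rw [← h u j]
  exact Finset.card_le_card fun w => by simp +contextual

theorem lt_cellCard (h : G.IsEquitable t k) (u : V) : k (t u) (t u) < cellCard t (t u) := by
  rw [← h u]
  refine Finset.card_lt_card ((Finset.ssubset_iff_of_subset fun w => by simp +contextual).2
    ⟨u, by simp, by simp⟩)

theorem adj_of_eq_cellCard (h : G.IsEquitable t k) {u w : V}
    (huw : k (t u) (t w) = cellCard t (t w)) : G.Adj u w := by
  rw [← h u, cellCard] at huw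
  have := Finset.eq_of_subset_of_card_le (fun x => by simp +contextual) huw.ge
  have hw : w ∈ Finset.univ.filter fun x => t x = t w := by simp
  rw [← this] at hw
  simpa using (Finset.mem_filter.1 hw).2.1

theorem exists_adj (h : G.IsEquitable t k) {u : V} {j : ι} (h0 : k (t u) j ≠ 0) :
    ∃ w, t w = j ∧ G.Adj u w := by
  rw [← h u j, Finset.card_ne_zero] at h0
  obtain ⟨w, hw⟩ := h0
  simp only [Finset.mem_filter] at hw
  exact ⟨w, hw.2.2, hw.2.1⟩

theorem exists_not_adj (h : G.IsEquitable t k) {u : V} {j : ι}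
    (h0 : k (t u) j ≠ cellCard t j) : ∃ w, t w = j ∧ ¬ G.Adj u w := by
  by_contra! hall
  apply h0
  rw [← h u j, cellCard]
  congr 1
  ext w
  simpa using hall w

theorem eq_sub_one_of_complete (h : G.IsEquitable t k) (u : V)
    (hc : ∀ v, t v = t u → v ≠ u → G.Adj u v) : k (t u) (t u) + 1 = cellCard t (t u) := by
  classical
  have h1 := Finset.card_erase_add_one (s := Finset.univ.filter fun w => t w = t u) (a := u)
    (by simp)
  rw [← h u, cellCard, ← h1]
  congr 2
  ext w
  simp only [Finset.mem_filter, Finset.mem_univ, true_and, Finset.mem_erase]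
  exact ⟨fun hw => ⟨hw.1.ne', hw.2⟩, fun hw => ⟨hc w hw.2 hw.1, hw.2⟩⟩

theorem eq_zero_of_empty (h : G.IsEquitable t k) (u : V)
    (hc : ∀ v, t v = t u → v ≠ u → ¬ G.Adj u v) : k (t u) (t u) = 0 := by
  rw [← h u, Finset.card_eq_zero, Finset.filter_eq_empty_iff]
  exact fun w _ hw => hc w hw.2 hw.1.ne' hw.1

end IsEquitable

variable [Fintype ι] {s p : ℝ} {a : ι → ℝ} [DecidableEq V]

/-- The adjacency matrix satisfies a quadratic equation up to a rank one matrix whose entries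
depend only on the cells. -/
def IsQuadratic (G : SimpleGraph V) [DecidableRel G.Adj] (t : V → ι) (s p : ℝ) (a : ι → ℝ) :
    Prop :=
  ∀ u v, ∑ w, G.adjMatrix ℝ u w * G.adjMatrix ℝ w v - s * G.adjMatrix ℝ u v +
    (if u = v then p else 0) = a (t u) * a (t v)

theorem IsEquitable.degree_equation (h : G.IsEquitable t k) (hq : G.IsQuadratic t s p a) (u : V) :
    ∑ j, (k (t u) j : ℝ) + p = a (t u) ^ 2 := by
  have h1 := hq u u
  have h2 := h.sum_adj_mul u fun _ => 1
  simp only [mul_one] at h2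
  rw [← h2]
  have h3 : ∀ w, G.adjMatrix ℝ u w * G.adjMatrix ℝ w u = G.adjMatrix ℝ u w := by
    intro w
    by_cases hw : G.Adj u w <;> simp [hw, G.adj_comm w u]
  simp only [h3] at h1
  simp at h1
  simp only [adjMatrix_apply]
  simp
  linarith

/-- This is the quadratic equation in row u summed over the columns in cell l. -/
theorem IsEquitable.quotient_equation (h : G.IsEquitable t k) (hq : G.IsQuadratic t s p a)
    (u : V) (l : ι) :
    ∑ j, (k (t u) j : ℝ) * k j l - s * k (t u) l + (if t u = l then p else 0) =
      a (t u) * a l * cellCard t l := by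
  rw [← h.sum_adj_mul u fun j => (k j l : ℝ)]
  simp_rw [← h.sum_adj]
  have h1 : (a (t u) * a l * cellCard t l : ℝ) =
      ∑ v, if t v = l then a (t u) * a (t v) else 0 := by
    rw [cellCard, Finset.card_filter]
    push_cast
    rw [Finset.mul_sum]
    refine Finset.sum_congr rfl fun v _ => ?_
    by_cases hv : t v = l <;> simp [hv]
  have h2 : (if t u = l then p else 0) = ∑ v, if t v = l then (if u = v then p else 0) else 0 := by
    rw [Finset.sum_eq_single u (fun v _ hv => by simp [hv.symm]) (by simp)]
    simp
  have h3 : ∀ v, a (t u) * a (t v) = _ := fun v => (hq u v).symm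
  rw [h1, h2]
  simp_rw [h3, Finset.mul_sum]
  rw [Finset.sum_comm, ← Finset.sum_sub_distrib, ← Finset.sum_add_distrib]
  refine Finset.sum_congr rfl fun v _ => ?_
  by_cases hv : t v = l <;> simp [hv]

omit [Fintype ι] in
-- Two non-adjacent vertices in the cell of u would have all of cell l as common neighbours, but the
-- quadratic equation allows them only `a (t u) ^ 2`.
theorem IsEquitable.complete_of_common_neighbors (h : G.IsEquitable t k)
    (hq : G.IsQuadratic t s p a) {u : V} {l : ι} (hk : k (t u) l = cellCard t l)
    (hlt : a (t u) ^ 2 < cellCard t l) : k (t u) (t u) + 1 = cellCard t (t u) := by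
  refine h.eq_sub_one_of_complete u fun v hv hvu => ?_
  by_contra hadj
  have h1 := hq u v
  rw [adjMatrix_apply, if_neg hadj, if_neg hvu.symm, hv] at h1
  have h2 : (cellCard t l : ℝ) ≤ ∑ w, G.adjMatrix ℝ u w * G.adjMatrix ℝ w v := by
    rw [cellCard, Finset.card_filter]
    push_cast
    refine Finset.sum_le_sum fun w _ => ?_
    by_cases hw : t w = l
    · have h3 : G.Adj u w := h.adj_of_eq_cellCard (by rw [hw, hk])
      have h4 : G.Adj w v := (h.adj_of_eq_cellCard (by rw [hw, hv, hk])).symm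
      simp [hw, h3, h4]
    · rw [if_neg hw]
      simp only [adjMatrix_apply]
      positivity
  nlinarith

end Equitable

/-! ### Infeasibility of the parameter equations -/

section Arithmetic

/-- No parameters are feasible for a join of three regular graphs. -/
theorem false_of_join_equations {a b c n₁ n₂ n₃ k₁ k₂ k₃ s p : ℝ} (ha : 0 < a)
    (hab : a ≠ b) (hac : a ≠ c)
    (d₁ : k₁ + n₂ + n₃ + p = a ^ 2) (d₂ : n₁ + k₂ + n₃ + p = b ^ 2)
    (d₃ : n₁ + n₂ + k₃ + p = c ^ 2) (q₁₂ : k₁ + k₂ + n₃ - s = a * b)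
    (q₁₃ : k₁ + k₃ + n₂ - s = a * c) (q₂₃ : k₂ + k₃ + n₁ - s = b * c) : False := by
  -- Both `d₁ - d₂` and `q₁₃ - q₂₃` evaluate k₁ + n₂ - n₁ - k₂, as a² - b² and as c(a - b).
  have h1 : c = a + b := mul_left_cancel₀ (sub_ne_zero.2 hab) (by linarith)
  have h2 : b = a + c := mul_left_cancel₀ (sub_ne_zero.2 hac) (by linarith)
  linarith

/-- No parameters are feasible for three regular graphs joined along a path. -/
theorem false_of_path_equations {a b c s p : ℝ} {n₁ n₂ n₃ k₁ k₂ k₃ : ℕ} (ha : 0 < a)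
    (hac : a < c) (hn₁ : 0 < n₁) (hn₂ : 0 < n₂)
    (hk₁ : k₁ + 1 = n₁) (hk₂ : k₂ < n₂)
    (d₁ : (k₁ + n₂ + p : ℝ) = a ^ 2) (d₂ : (n₁ + k₂ + n₃ + p : ℝ) = b ^ 2)
    (d₃ : (n₂ + k₃ + p : ℝ) = c ^ 2) (q₁₂ : k₁ + k₂ - s = a * b) (q₂₃ : k₂ + k₃ - s = b * c)
    (q₁₃ : (n₂ : ℝ) = a * c) (q₁₁ : k₁ ^ 2 + n₂ * n₁ - s * k₁ + p = a ^ 2 * n₁)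
    (q₃₃ : k₃ ^ 2 + n₂ * n₃ - s * k₃ + p = c ^ 2 * n₃) : False := by
  have hb : b = a + c := mul_left_cancel₀ (sub_ne_zero.2 hac.ne) (by linarith)
  have hk₂' : (k₂ : ℝ) + 1 ≤ n₂ := by exact_mod_cast hk₂
  have hn₂' : (1 : ℝ) ≤ n₂ := by exact_mod_cast hn₂
  have hk₁' : (k₁ : ℝ) + 1 = n₁ := by exact_mod_cast hk₁
  -- Otherwise 1 + s + p = 0, which forces k₂ = 2n₂ - 1, too many for a cell of n₂ vertices.
  have hk₁0 : k₁ = 0 := by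
    by_contra h0
    have h1 : (k₁ : ℝ) * (1 + s + p) = 0 := by
      rw [← hk₁', ← d₁] at q₁₁
      linear_combination -q₁₁
    have h2 : 1 + s + p = 0 := (mul_eq_zero.1 h1).resolve_left (by exact_mod_cast h0)
    have h3 : (k₂ : ℝ) = 2 * n₂ - 1 := by
      rw [hb] at q₁₂
      linear_combination q₁₂ + h2 - d₁ - 2 * q₁₃ + q₁₃
    linarith
  have hn₁1 : n₁ = 1 := by omega
  subst hk₁0 hn₁1
  have hc : 0 < c := ha.trans hac
  push_cast at *
  -- Eliminating all variables but a, c and s from `q₃₃` leaves an equation divisible by c - a.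
  have hs : a * s = c - a - a ^ 3 - a * c ^ 2 := by
    subst hb
    have e1 : (n₂ : ℝ) = a * c := q₁₃
    have e2 : p = a ^ 2 - a * c := by linarith
    have e3 : (k₃ : ℝ) = c ^ 2 - a ^ 2 := by linarith
    have e4 : (k₂ : ℝ) = s + a * (a + c) := by linarith
    have e5 : (n₃ : ℝ) = (a + c) ^ 2 - p - 1 - k₂ := by linarith
    rw [e5, e4, e3, e2, e1] at q₃₃
    have : (c - a) * (a * s - (c - a - a ^ 3 - a * c ^ 2)) = 0 := by
      ring_nf at q₃₃ ⊢
      linarith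
    linarith [(mul_eq_zero.1 this).resolve_left (sub_ne_zero.2 hac.ne')]
  have hk₂eq : a * k₂ = (c - a) * (1 - a * c) := by
    subst hb
    linear_combination a * q₁₂ + hs
  have hle : a * c ≤ 1 := by
    by_contra! hlt
    nlinarith [mul_pos (sub_pos.2 hac) (sub_pos.2 hlt), mul_nonneg ha.le (Nat.cast_nonneg (α := ℝ) k₂)]
  have hone : a * c = 1 := le_antisymm hle (q₁₃ ▸ hn₂')
  have hn₂1 : n₂ = 1 := by exact_mod_cast q₁₃.trans hone
  have hk₂0 : k₂ = 0 := by omega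
  subst hn₂1 hk₂0
  have hk₃ : (k₃ : ℝ) = c ^ 2 - a ^ 2 := by push_cast at *; linarith
  have hs' : s = -1 - a ^ 2 := by
    subst hb
    push_cast at *
    linarith
  have hn₃ : (n₃ : ℝ) = c ^ 2 + 2 := by
    subst hb
    push_cast at *
    nlinarith
  have hcc : c ^ 2 * a ^ 2 = 1 := by rw [← mul_pow, mul_comm, hone, one_pow]
  have hacc : a ^ 2 < c ^ 2 := pow_lt_pow_left₀ hac ha.le two_ne_zero
  -- The integer n₃ - k₃ - 2 equals a² > 0, so a² ≥ 1; this contradicts ac = 1 with a < c.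
  have hk₃n : k₃ + 2 < n₃ := by
    have : (k₃ : ℝ) + 2 < n₃ := by rw [hk₃, hn₃]; nlinarith [pow_pos ha 2]
    exact_mod_cast this
  have hgap : (k₃ : ℝ) + 3 ≤ n₃ := by exact_mod_cast hk₃n
  have : 1 ≤ a ^ 2 := by linarith
  nlinarith

/-- No parameters are feasible for two cells that are complete or empty, joined by a symmetric
design, and a third cell with a single vertex. -/
theorem false_of_design_equations {a b c n₁ n₂ k k' s p e₁ e₂ d₁ d₂ : ℝ} (ha : 0 < a)
    (hb : 0 < b) (hc : 0 < c) (hab : a ≠ b) (hac : a ≠ c) (hbc : b ≠ c)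
    (he₁ : e₁ = 0 ∨ e₁ = 1) (he₂ : e₂ = 0 ∨ e₂ = 1) (hd₁ : d₁ = 0 ∨ d₁ = 1)
    (hd₂ : d₂ = 0 ∨ d₂ = 1) (hk : 0 < k) (hk' : k' < n₁) (hkn : k < n₂)
    (hcount : n₁ * k = n₂ * k')
    (hs : s = -(e₁ + e₂)) (q₁₂ : e₁ * k' + e₂ * k + d₁ * d₂ = a * b)
    (q₁₃ : d₁ * e₁ * (n₁ - 1) + d₂ * k - s * d₁ = a * c)
    (q₂₃ : d₂ * e₂ * (n₂ - 1) + d₁ * k' - s * d₂ = b * c)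
    (g₁ : e₁ * (n₁ - 1) + k + d₁ + p = a ^ 2) (g₂ : e₂ * (n₂ - 1) + k' + d₂ + p = b ^ 2)
    (g₃ : d₁ * n₁ + d₂ * n₂ + p = c ^ 2)
    (q₁₁ : (e₁ * (n₁ - 1)) ^ 2 + k * k' + d₁ * (d₁ * n₁) - s * (e₁ * (n₁ - 1)) + p = a ^ 2 * n₁)
    (q₂₂ : (e₂ * (n₂ - 1)) ^ 2 + k' * k + d₂ * (d₂ * n₂) - s * (e₂ * (n₂ - 1)) + p =
      b ^ 2 * n₂) : False := by
  have sq_self : ∀ x : ℝ, x = 0 ∨ x = 1 → x * x = x := by rintro x (rfl | rfl) <;> norm_num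
  -- Eliminating a² from `q₁₁` and b² from `q₂₂` gives the same right-hand side and the same factor
  -- p - e₁e₂, which is nonzero; hence n₁ = n₂ and k = k'.
  have h1 : (n₁ - 1) * (p - e₁ * e₂) = k * (k' - n₁) := by
    rw [← g₁, hs] at q₁₁
    linear_combination (n₁ - 1) * n₁ * sq_self e₁ he₁
      + n₁ * sq_self d₁ hd₁ - q₁₁
  have h2 : (n₂ - 1) * (p - e₁ * e₂) = k * (k' - n₁) := by
    rw [← g₂, hs] at q₂₂
    linear_combination (n₂ - 1) * n₂ * sq_self e₂ he₂
      + n₂ * sq_self d₂ hd₂ - q₂₂ + hcount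
  have hneg : k * (k' - n₁) < 0 := mul_neg_of_pos_of_neg hk (sub_neg.2 hk')
  have hX : p - e₁ * e₂ ≠ 0 := by
    intro h
    rw [h, mul_zero] at h1
    linarith
  have hn : n₁ = n₂ := by linarith [mul_right_cancel₀ hX (h1.trans h2.symm)]
  subst hn
  have hn₁ : n₁ ≠ 0 := (hk.trans hkn).ne'
  have hkk : k = k' := mul_left_cancel₀ hn₁ hcount
  subst hkk hs
  have hab' : a ^ 2 ≠ b ^ 2 := fun h => hab ((sq_eq_sq₀ ha.le hb.le).1 h)
  have pab := mul_pos ha hb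
  have pac := mul_pos ha hc
  have pbc := mul_pos hb hc
  have hac' : a * b ≠ b * c := fun h => hac (mul_left_cancel₀ hb.ne' (by linarith))
  have hbc' : a * b ≠ a * c := fun h => hbc (mul_left_cancel₀ ha.ne' h)
  have hab'' : a * c ≠ b * c := fun h => hab (mul_right_cancel₀ hc.ne' h)
  rcases he₁ with rfl | rfl <;> rcases he₂ with rfl | rfl <;> rcases hd₁ with rfl | rfl <;>
    rcases hd₂ with rfl | rfl
  all_goals first
    | linarith
    | exact hab' (by linarith)
    | exact hac' (by linarith)
    | exact hbc' (by linarith)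
    | exact hab'' (by linarith)
    | skip
  -- The two remaining cases have both cells complete and the single vertex joined to exactly one of
  -- them.
  · have : b = 2 * c := mul_left_cancel₀ ha.ne' (by linarith)
    subst this
    nlinarith
  · have : a = 2 * c := mul_left_cancel₀ hb.ne' (by linarith)
    subst this
    nlinarith

end Arithmetic

end SimpleGraph

namespace SimpleGraph

/-! ### Equitable partitions with three cells -/

section ThreeCells

variable {V : Type*} [Fintype V] {G : SimpleGraph V} [DecidableRel G.Adj]

theorem sum_eq_add_add {i j l : Fin 3} (hij : i ≠ j) (hil : i ≠ l) (hjl : j ≠ l)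
    {M : Type*} [AddCommMonoid M] (f : Fin 3 → M) : ∑ m, f m = f i + f j + f l := by
  have : (Finset.univ : Finset (Fin 3)) = {i, j, l} := by
    revert i j l
    decide
  rw [this, Finset.sum_insert (by simp [hij, hil]), Finset.sum_pair hjl, add_assoc]

theorem eq_or_eq_or_eq {i j l : Fin 3} (hij : i ≠ j) (hil : i ≠ l) (hjl : j ≠ l) (m : Fin 3) :
    m = i ∨ m = j ∨ m = l := by
  revert i j l m
  decide

theorem IsEquitable.not_adj_of_eq_zero {ι : Type*} [DecidableEq ι] {t : V → ι}
    {k : ι → ι → ℕ} (h : G.IsEquitable t k) {u w : V} (h0 : k (t u) (t w) = 0) :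
    ¬ G.Adj u w := by
  rw [← h u, Finset.card_eq_zero, Finset.filter_eq_empty_iff] at h0
  exact fun hadj => h0 (Finset.mem_univ w) ⟨hadj, rfl⟩

theorem cellCard_pos {ι : Type*} [DecidableEq ι] {t : V → ι} (hsurj : Function.Surjective t)
    (i : ι) : 0 < cellCard t i := by
  obtain ⟨u, rfl⟩ := hsurj i
  exact Finset.card_pos.2 ⟨u, by simp⟩

variable [DecidableEq V] {t : V → Fin 3} {k : Fin 3 → Fin 3 → ℕ} {s p : ℝ} {a : Fin 3 → ℝ}

/-- Non-adjacent cells i and j still need common neighbours, as a i * a j > 0, so both are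
completely joined to l and l has a i * a j vertices. That exceeds a i ^ 2, hence cell i is complete.
-/
theorem IsEquitable.false_of_path (h : G.IsEquitable t k) (hq : G.IsQuadratic t s p a)
    (hsurj : Function.Surjective t) (ha : ∀ i, 0 < a i)
    (hom : ∀ i j, i ≠ j → k i j = 0 ∨ k i j = cellCard t j) {i j l : Fin 3} (hil : i ≠ l)
    (hij : i ≠ j) (hlj : l ≠ j) (hk : k i j = 0) (hlt : a i < a j) : False := by
  have hpos := cellCard_pos hsurj
  have hposR : ∀ m, (0 : ℝ) < cellCard t m := fun m => by exact_mod_cast hpos m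
  have deg : ∀ m, ∑ x, (k m x : ℝ) + p = a m ^ 2 := fun m => by
    obtain ⟨u, rfl⟩ := hsurj m
    exact h.degree_equation hq u
  have quo : ∀ m x, ∑ y, (k m y : ℝ) * k y x - s * k m x + (if m = x then p else 0) =
      a m * a x * cellCard t x := fun m x => by
    obtain ⟨u, rfl⟩ := hsurj m
    exact h.quotient_equation hq u x
  have hlt' : ∀ m, k m m < cellCard t m := fun m => by
    obtain ⟨u, rfl⟩ := hsurj m
    exact h.lt_cellCard u
  have symm_full : ∀ x y, k x y = cellCard t y → k y x = cellCard t x := fun x y hxy => by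
    have := h.mul_comm_card x y
    rw [hxy, mul_comm] at this
    exact (Nat.eq_of_mul_eq_mul_left (hpos y) this).symm
  simp only [sum_eq_add_add hil hij hlj] at deg quo
  have hkj : k j i = 0 := by
    have := h.mul_comm_card i j
    rw [hk, mul_zero] at this
    exact (mul_eq_zero.1 this.symm).resolve_left (hpos j).ne'
  have qij := quo i j
  simp only [hk, hij, if_false, Nat.cast_zero, mul_zero, zero_mul] at qij
  have hprod : (0 : ℝ) < k i l * k l j := by
    have := mul_pos (mul_pos (ha i) (ha j)) (hposR j)
    linarith
  have kil := (hom i l hil).resolve_left (by rintro h0; simp [h0] at hprod)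
  have klj := (hom l j hlj).resolve_left (by rintro h0; simp [h0] at hprod)
  have kli := symm_full _ _ kil
  have kjl := symm_full _ _ klj
  have hn : (cellCard t l : ℝ) = a i * a j := by
    rw [kil, klj] at qij
    exact mul_right_cancel₀ (hposR j).ne' (by linarith)
  have hcomp : k i i + 1 = cellCard t i := by
    have hsq : a i ^ 2 < cellCard t l := by
      rw [hn, sq]
      exact mul_lt_mul_of_pos_left hlt (ha i)
    obtain ⟨u, rfl⟩ := hsurj i
    exact h.complete_of_common_neighbors hq kil hsq
  have d₁ := deg i
  have d₂ := deg l
  have d₃ := deg j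
  have qil := quo i l
  have qlj := quo l j
  have qii := quo i i
  have qjj := quo j j
  simp only [hk, hkj, kil, klj, kli, kjl, hil, hlj, if_false, if_true, Nat.cast_zero, mul_zero,
    zero_mul, add_zero, zero_add] at d₁ d₂ d₃ qil qlj qii qjj
  refine false_of_path_equations (b := a l) (n₃ := cellCard t j) (s := s) (ha i) hlt (hpos i) (hpos l) hcomp (hlt' l)
    d₁ (by linarith) d₃ ?_ ?_ hn (by linarith) (by linarith)
  · exact mul_right_cancel₀ (hposR l).ne' (by linarith)
  · exact mul_right_cancel₀ (hposR j).ne' (by linarith)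

/-- The cells of the degree partition cannot all be pairwise completely joined or completely
non-adjacent. -/
theorem IsEquitable.exists_ne_zero_ne_cellCard (h : G.IsEquitable t k)
    (hq : G.IsQuadratic t s p a) (hsurj : Function.Surjective t) (ha : ∀ i, 0 < a i)
    (hinj : Function.Injective a) : ∃ i j, i ≠ j ∧ k i j ≠ 0 ∧ k i j ≠ cellCard t j := by
  by_contra! hcon
  have hom : ∀ i j, i ≠ j → k i j = 0 ∨ k i j = cellCard t j := fun i j hij =>
    or_iff_not_imp_left.2 (hcon i j hij)
  have hpos := cellCard_pos hsurj
  have hposR : ∀ m, (0 : ℝ) < cellCard t m := fun m => by exact_mod_cast hpos m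
  have third : ∀ i j : Fin 3, i ≠ j → ∃ l, i ≠ l ∧ l ≠ j := by decide
  have full : ∀ i j, i ≠ j → k i j = cellCard t j := by
    intro i j hij
    refine (hom i j hij).resolve_left fun h0 => ?_
    obtain ⟨l, hil, hlj⟩ := third i j hij
    rcases lt_or_gt_of_ne (hinj.ne hij) with hlt | hlt
    · exact h.false_of_path hq hsurj ha hom hil hij hlj h0 hlt
    · have hkj : k j i = 0 := by
        have := h.mul_comm_card i j
        rw [h0, mul_zero] at this
        exact (mul_eq_zero.1 this.symm).resolve_left (hpos j).ne'
      exact h.false_of_path hq hsurj ha hom hlj.symm hij.symm hil.symm hkj hlt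
  have deg : ∀ m, ∑ x, (k m x : ℝ) + p = a m ^ 2 := fun m => by
    obtain ⟨u, rfl⟩ := hsurj m
    exact h.degree_equation hq u
  have quo : ∀ m x, ∑ y, (k m y : ℝ) * k y x - s * k m x + (if m = x then p else 0) =
      a m * a x * cellCard t x := fun m x => by
    obtain ⟨u, rfl⟩ := hsurj m
    exact h.quotient_equation hq u x
  have q₀₁ := quo 0 1
  have q₀₂ := quo 0 2
  have q₁₂ := quo 1 2
  have d₀ := deg 0
  have d₁ := deg 1
  have d₂ := deg 2
  simp only [Fin.sum_univ_three, full 0 1 (by decide), full 0 2 (by decide),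
    full 1 0 (by decide), full 1 2 (by decide), full 2 0 (by decide), full 2 1 (by decide),
    show (0 : Fin 3) ≠ 1 by decide, show (0 : Fin 3) ≠ 2 by decide,
    show (1 : Fin 3) ≠ 2 by decide, if_false, add_zero] at q₀₁ q₀₂ q₁₂ d₀ d₁ d₂
  refine false_of_join_equations (s := s) (ha 0) (hinj.ne (by decide : (0 : Fin 3) ≠ 1))
    (hinj.ne (by decide : (0 : Fin 3) ≠ 2)) d₀ d₁ d₂
    (mul_right_cancel₀ (hposR 1).ne' ?_) (mul_right_cancel₀ (hposR 2).ne' ?_)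
    (mul_right_cancel₀ (hposR 2).ne' ?_) <;> linarith

/-- The case left by the count of 13 classes. Completeness or emptiness of cells i and j makes
common neighbours of a pair between them computable entry by entry. -/
theorem IsEquitable.false_of_design (h : G.IsEquitable t k) (hq : G.IsQuadratic t s p a)
    (hsurj : Function.Surjective t) (ha : ∀ i, 0 < a i) (hinj : Function.Injective a)
    {i j l : Fin 3} (hij : i ≠ j) (hil : i ≠ l) (hjl : j ≠ l) (h0 : k i j ≠ 0)
    (h1 : k i j ≠ cellCard t j) (hl : cellCard t l = 1)
    (hi : (∀ u v, t u = i → t v = i → u ≠ v → G.Adj u v) ∨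
      ∀ u v, t u = i → t v = i → u ≠ v → ¬ G.Adj u v)
    (hj : (∀ u v, t u = j → t v = j → u ≠ v → G.Adj u v) ∨
      ∀ u v, t u = j → t v = j → u ≠ v → ¬ G.Adj u v) : False := by
  have hpos := cellCard_pos hsurj
  have hle : ∀ m x, k m x ≤ cellCard t x := fun m x => by
    obtain ⟨u, rfl⟩ := hsurj m
    exact h.le_cellCard u x
  have hlt : ∀ m, k m m < cellCard t m := fun m => by
    obtain ⟨u, rfl⟩ := hsurj m
    exact h.lt_cellCard u
  have uniform : ∀ m, ((∀ u v, t u = m → t v = m → u ≠ v → G.Adj u v) ∨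
      ∀ u v, t u = m → t v = m → u ≠ v → ¬ G.Adj u v) →
      ∃ e : ℝ, (e = 0 ∨ e = 1) ∧ (k m m : ℝ) = e * (cellCard t m - 1) ∧
        ∀ u v, t u = m → t v = m → u ≠ v → G.adjMatrix ℝ u v = e := by
    intro m hm
    obtain ⟨u, rfl⟩ := hsurj m
    rcases hm with hm | hm
    · refine ⟨1, Or.inr rfl, ?_, fun x y hx hy hxy => by simp [hm x y hx hy hxy]⟩
      rw [← h.eq_sub_one_of_complete u fun v hv hvu => hm u v rfl hv hvu.symm]
      push_cast
      ring
    · refine ⟨0, Or.inl rfl, ?_, fun x y hx hy hxy => by simp [hm x y hx hy hxy]⟩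
      rw [h.eq_zero_of_empty u fun v hv hvu => hm u v rfl hv hvu.symm]
      simp
  obtain ⟨e₁, he₁, hk₁, hadj₁⟩ := uniform i hi
  obtain ⟨e₂, he₂, hk₂, hadj₂⟩ := uniform j hj
  have zero_or_one : ∀ m, (k m l : ℝ) = 0 ∨ (k m l : ℝ) = 1 := fun m => by
    have := hle m l
    rw [hl] at this
    interval_cases k m l <;> simp
  have hadjl : ∀ u w, t w = l → G.adjMatrix ℝ u w = k (t u) l := by
    rintro u w rfl
    have := hle (t u) (t w)
    rw [hl] at this
    rcases Nat.le_one_iff_eq_zero_or_eq_one.1 this with hk | hk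
    · rw [hk]
      simp [h.not_adj_of_eq_zero hk]
    · rw [hk]
      simp [h.adj_of_eq_cellCard (hk.trans hl.symm)]
  have c₁₂ : (cellCard t i * k i j : ℝ) = cellCard t j * k j i := by
    exact_mod_cast h.mul_comm_card i j
  have kli : (k l i : ℝ) = cellCard t i * k i l := by
    have := h.mul_comm_card l i
    rw [hl, one_mul] at this
    exact_mod_cast this
  have klj : (k l j : ℝ) = cellCard t j * k j l := by
    have := h.mul_comm_card l j
    rw [hl, one_mul] at this
    exact_mod_cast this
  have kll : k l l = 0 := by
    have := hlt l
    omega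
  have hkpos : (0 : ℝ) < k i j := by exact_mod_cast Nat.pos_of_ne_zero h0
  have hkn : (k i j : ℝ) < cellCard t j := by exact_mod_cast lt_of_le_of_ne (hle i j) h1
  have hposR : ∀ m, (0 : ℝ) < cellCard t m := fun m => by exact_mod_cast hpos m
  have hkn' : (k j i : ℝ) < cellCard t i := by
    by_contra! hge
    nlinarith [mul_lt_mul_of_pos_left hkn (hposR i), mul_le_mul_of_nonneg_left hge (hposR j).le]
  -- Counts the common neighbours of a non-adjacent pair between cells i and j, which exists because
  -- k i j is not the full cell size.
  have q₁₂ : e₁ * k j i + e₂ * k i j + k i l * k j l = a i * a j := by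
    obtain ⟨u, hu⟩ := hsurj i
    obtain ⟨v, hv, huv⟩ := h.exists_not_adj (u := u) (j := j) (by rwa [hu])
    have hne : u ≠ v := fun huv' => hij (by rw [← hu, ← hv, huv'])
    have hent := hq u v
    have hAuv : G.adjMatrix ℝ u v = 0 := by simp [huv]
    have hsymm : ∀ x y, G.adjMatrix ℝ x y = G.adjMatrix ℝ y x := fun x y => by
      simp [G.adj_comm]
    rw [hAuv, if_neg hne, hu, hv] at hent
    have hpt : ∀ w, G.adjMatrix ℝ u w * G.adjMatrix ℝ w v =
        e₁ * (if t w = i then G.adjMatrix ℝ v w else 0) +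
        e₂ * (if t w = j then G.adjMatrix ℝ u w else 0) +
        k i l * (if t w = l then G.adjMatrix ℝ v w else 0) := by
      intro w
      rcases eq_or_eq_or_eq hij hil hjl (t w) with hw | hw | hw
      · rw [if_pos hw, if_neg (by rwa [hw]), if_neg (by rwa [hw])]
        rw [hsymm w v]
        by_cases hwu : u = w
        · rw [← hwu, hsymm v u, hAuv]
          ring
        · rw [hadj₁ u w hu hw hwu]
          ring
      · rw [if_neg (by rw [hw]; exact hij.symm), if_pos hw, if_neg (by rwa [hw])]
        by_cases hwv : w = v
        · rw [hwv, hAuv]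
          ring
        · rw [hadj₂ w v hw hv hwv]
          ring
      · rw [if_neg (by rw [hw]; exact hil.symm), if_neg (by rw [hw]; exact hjl.symm), if_pos hw,
          hsymm w v, hadjl u w hw, hu]
        ring
    simp only [hpt, Finset.sum_add_distrib, ← Finset.mul_sum, h.sum_adj, hu, hv] at hent
    linarith
  have deg : ∀ m, ∑ x, (k m x : ℝ) + p = a m ^ 2 := fun m => by
    obtain ⟨u, rfl⟩ := hsurj m
    exact h.degree_equation hq u
  have quo : ∀ m x, ∑ y, (k m y : ℝ) * k y x - s * k m x + (if m = x then p else 0) =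
      a m * a x * cellCard t x := fun m x => by
    obtain ⟨u, rfl⟩ := hsurj m
    exact h.quotient_equation hq u x
  simp only [sum_eq_add_add hij hil hjl] at deg quo
  have qij := quo i j
  have qil := quo i l
  have qjl := quo j l
  have qii := quo i i
  have qjj := quo j j
  have d₁ := deg i
  have d₂ := deg j
  have d₃ := deg l
  simp only [hk₁, hk₂, kli, klj, kll, hl, hij, hil, hjl, if_false, if_true, Nat.cast_zero,
    Nat.cast_one, add_zero, mul_zero, mul_one] at qij qil qjl qii qjj d₁ d₂ d₃
  -- The quotient equation averages over adjacent and non-adjacent pairs; removing the non-adjacent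
  -- count isolates s.
  have hs : s = -(e₁ + e₂) := by
    have : (s + (e₁ + e₂)) * k i j = 0 := by
      rw [← q₁₂] at qij
      linear_combination e₁ * c₁₂ - qij
    linarith [(mul_eq_zero.1 this).resolve_right hkpos.ne']
  exact false_of_design_equations (ha i) (ha j) (ha l) (hinj.ne hij) (hinj.ne hil) (hinj.ne hjl)
    he₁ he₂ (zero_or_one i) (zero_or_one j) hkpos hkn' hkn c₁₂ hs q₁₂ (by linarith)
    (by linarith) (by linarith) (by linarith) (by linarith) (by linarith) (by linarith)

end ThreeCells

end SimpleGraph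

/-! ### Counting classes block by block -/

section BlockRank

variable {V : Type*} [Fintype V] [DecidableEq V] {ι : Type*} [DecidableEq ι]

open Classical in
/-- The number of classes of positions of an algebra in a block of a partition. -/
noncomputable def Subalgebra.blockRank (S : Subalgebra ℂ (Matrix V V ℂ)) (t : V → ι) (i j : ι) :
    ℕ :=
  ((Finset.univ.filter fun x : V × V => t x.1 = i ∧ t x.2 = j).image
    fun x => S.colour x.1 x.2).card

variable {S : Subalgebra ℂ (Matrix V V ℂ)} {t : V → ι}

open Classical in
theorem IsCoherentAlgebra.sum_blockRank_le [Fintype ι] (hS : IsCoherentAlgebra S)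
    (ht : ∀ u v, S.colour u u = S.colour v v → t u = t v) :
    ∑ i, ∑ j, S.blockRank t i j ≤ Nat.card (Quotient S.entrySetoid) := by
  have := Fintype.ofFinite (Quotient S.entrySetoid)
  rw [← Fintype.sum_prod_type', Nat.card_eq_fintype_card]
  unfold Subalgebra.blockRank
  rw [← Finset.card_biUnion]
  · exact Finset.card_le_univ _
  · intro x _ y _ hxy
    rw [Function.onFun, Finset.disjoint_left]
    intro c hx hy
    obtain ⟨z, hz, rfl⟩ := Finset.mem_image.1 hx
    obtain ⟨w, hw, hwz⟩ := Finset.mem_image.1 hy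
    simp only [Finset.mem_filter, Finset.mem_univ, true_and] at hz hw
    apply hxy
    ext1
    · rw [← hz.1, ← hw.1]
      exact (ht _ _ (hS.colour_diag_left hwz)).symm
    · rw [← hz.2, ← hw.2]
      exact (ht _ _ (hS.colour_diag_right hwz)).symm

theorem one_le_blockRank (u v : V) : 1 ≤ S.blockRank t (t u) (t v) := by
  classical
  exact Finset.card_pos.2 ⟨_, Finset.mem_image_of_mem _ (a := (u, v)) (by simp)⟩

theorem two_le_blockRank {u v u' v' : V} (hu : t u = t u') (hv : t v = t v')
    (h : S.colour u v ≠ S.colour u' v') : 2 ≤ S.blockRank t (t u) (t v) := by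
  classical
  exact Finset.one_lt_card.2 ⟨_, Finset.mem_image_of_mem _ (a := (u, v)) (by simp), _,
    Finset.mem_image_of_mem _ (a := (u', v')) (by simp [hu, hv]), h⟩

theorem three_le_blockRank {u v u' v' u'' v'' : V} (hu : t u = t u') (hv : t v = t v')
    (hu' : t u = t u'') (hv' : t v = t v'') (h : S.colour u v ≠ S.colour u' v')
    (h' : S.colour u v ≠ S.colour u'' v'') (h'' : S.colour u' v' ≠ S.colour u'' v'') :
    3 ≤ S.blockRank t (t u) (t v) := by
  classical
  exact Finset.two_lt_card.2 ⟨_, Finset.mem_image_of_mem _ (a := (u, v)) (by simp), _,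
    Finset.mem_image_of_mem _ (a := (u', v')) (by simp [hu, hv]), _,
    Finset.mem_image_of_mem _ (a := (u'', v'')) (by simp [hu', hv']), h, h', h''⟩

end BlockRank

namespace SimpleGraph

variable {V : Type*} [Fintype V] [DecidableEq V] {G : SimpleGraph V} [DecidableRel G.Adj]

theorem two_le_blockRank_of_one_lt {S : Subalgebra ℂ (Matrix V V ℂ)} {ι : Type*} [DecidableEq ι]
    {t : V → ι} {i : ι} (h : 1 < cellCard t i) : 2 ≤ S.blockRank t i i := by
  obtain ⟨u, hu, v, hv, huv⟩ := Finset.one_lt_card.1 h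
  simp only [Finset.mem_filter, Finset.mem_univ, true_and] at hu hv
  subst hu
  exact two_le_blockRank (u := u) (v := u) (u' := u) (v' := v) rfl hv.symm fun hc =>
    huv ((IsCoherentAlgebra.eq_iff_of_colour_eq hc).1 rfl)

/-- Diagonal positions, edges and non-edges inside a cell lie in different classes. -/
theorem complete_or_empty_of_blockRank_lt {S : Subalgebra ℂ (Matrix V V ℂ)}
    (hA : G.adjMatrix ℂ ∈ S) {ι : Type*} [DecidableEq ι] {t : V → ι} {i : ι}
    (h : S.blockRank t i i < 3) : (∀ u v, t u = i → t v = i → u ≠ v → G.Adj u v) ∨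
      ∀ u v, t u = i → t v = i → u ≠ v → ¬ G.Adj u v := by
  by_contra! hcon
  obtain ⟨⟨u, v, hu, hv, huv, hadj⟩, u', v', hu', hv', huv', hadj'⟩ := hcon
  refine h.not_ge ?_
  subst hu
  exact three_le_blockRank (u := u) (v := u) (u' := u) (v' := v) (u'' := u') (v'' := v')
    rfl hv.symm hu'.symm hv'.symm
    (fun hc => huv ((IsCoherentAlgebra.eq_iff_of_colour_eq hc).1 rfl))
    (fun hc => huv' ((IsCoherentAlgebra.eq_iff_of_colour_eq hc).1 rfl))
    (fun hc => hadj ((adj_iff_of_colour_eq hA hc).2 hadj'))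

theorem IsEquitable.two_le_blockRank {S : Subalgebra ℂ (Matrix V V ℂ)}
    (hA : G.adjMatrix ℂ ∈ S) {ι : Type*} [DecidableEq ι] {t : V → ι} {k : ι → ι → ℕ}
    (h : G.IsEquitable t k) (hsurj : Function.Surjective t) {i j : ι} (h0 : k i j ≠ 0)
    (h1 : k i j ≠ cellCard t j) : 2 ≤ S.blockRank t i j := by
  obtain ⟨u, rfl⟩ := hsurj i
  obtain ⟨v, rfl, huv⟩ := h.exists_adj h0
  obtain ⟨w, hw, huw⟩ := h.exists_not_adj h1
  exact _root_.two_le_blockRank (u' := u) (v' := w) rfl hw.symm fun hc =>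
    huw ((adj_iff_of_colour_eq hA hc).1 huv)

/-- If the degree partition is equitable, there are at least fourteen classes of positions. -/
theorem IsEquitable.fourteen_le {S : Subalgebra ℂ (Matrix V V ℂ)} (hS : IsCoherentAlgebra S)
    (hA : G.adjMatrix ℂ ∈ S) {t : V → Fin 3} {k : Fin 3 → Fin 3 → ℕ} {s p : ℝ} {a : Fin 3 → ℝ}
    (h : G.IsEquitable t k) (hq : G.IsQuadratic t s p a) (hsurj : Function.Surjective t)
    (ha : ∀ i, 0 < a i) (hinj : Function.Injective a)
    (ht : ∀ u v, S.colour u u = S.colour v v → t u = t v) :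
    14 ≤ Nat.card (Quotient S.entrySetoid) := by
  by_contra! hlt
  obtain ⟨i, j, hij, h0, h1⟩ := h.exists_ne_zero_ne_cellCard hq hsurj ha hinj
  obtain ⟨l, hil, hjl⟩ : ∃ l, i ≠ l ∧ j ≠ l :=
    (by decide : ∀ i j : Fin 3, ∃ l, i ≠ l ∧ j ≠ l) i j
  have hpos := cellCard_pos hsurj
  have hcount := h.mul_comm_card i j
  have h0' : k j i ≠ 0 := fun hz => by
    rw [hz, mul_zero] at hcount
    exact h0 ((mul_eq_zero.1 hcount).resolve_left (hpos i).ne')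
  have h1' : k j i ≠ cellCard t i := fun hz => by
    rw [hz, mul_comm] at hcount
    exact h1 (Nat.eq_of_mul_eq_mul_right (hpos i) hcount)
  have hle : ∀ m x, k m x ≤ cellCard t x := fun m x => by
    obtain ⟨u, rfl⟩ := hsurj m
    exact h.le_cellCard u x
  have hone : ∀ m x, 1 ≤ S.blockRank t m x := fun m x => by
    obtain ⟨u, rfl⟩ := hsurj m
    obtain ⟨v, rfl⟩ := hsurj x
    exact one_le_blockRank u v
  -- Since k j i lies strictly between 0 and the size of cell i, that cell has at least two
  -- vertices.
  have hii : 2 ≤ S.blockRank t i i := two_le_blockRank_of_one_lt (by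
    have := hle j i
    omega)
  have hjj : 2 ≤ S.blockRank t j j := two_le_blockRank_of_one_lt (by
    have := hle i j
    omega)
  have hbij := h.two_le_blockRank (S := S) hA hsurj h0 h1
  have hbji := h.two_le_blockRank (S := S) hA hsurj h0' h1'
  have hsum := hS.sum_blockRank_le ht
  simp only [sum_eq_add_add hij hil hjl] at hsum
  have := hone i l
  have := hone l i
  have := hone j l
  have := hone l j
  have := hone l l
  -- The bounds so far total 13, so with fewer than 14 classes each of them is attained.
  have hl : cellCard t l = 1 := by
    by_contra hne
    have : 2 ≤ S.blockRank t l l := two_le_blockRank_of_one_lt (by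
      have := hpos l
      omega)
    omega
  exact h.false_of_design hq hsurj ha hinj hij hil hjl h0 h1 hl
    (complete_or_empty_of_blockRank_lt hA (by omega))
    (complete_or_empty_of_blockRank_lt hA (by omega))

end SimpleGraph

/-! ### The theorem: degree partition equal to the diagonal classes, or properly refined -/

theorem theorem6p1 {V : Type*} [Fintype V] [DecidableEq V] (G : SimpleGraph V)
    [DecidableRel G.Adj] (hconn : G.Connected) (heig : G.distinctEigenvalues.ncard = 3)
    (htri : G.IsTriregular) : 14 ≤ G.coherentRank := by
  have hS := G.isCoherentAlgebra_coherentClosure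
  have hA := G.adjMatrix_mem_coherentClosure
  refine le_trans ?_ hS.card_quotient_le
  obtain ⟨t, hsurj, ht⟩ : ∃ t : V → Fin 3, Function.Surjective t ∧
      ∀ u v, t u = t v ↔ G.degree u = G.degree v := by
    have e := Finite.equivFinOfCardEq (α := Set.range fun v : V => G.degree v) htri
    exact ⟨e ∘ Set.rangeFactorization _, e.surjective.comp Set.rangeFactorization_surjective,
      fun u v => by simp [Set.rangeFactorization]⟩
  obtain ⟨g, hg⟩ := hsurj.hasRightInverse
  have htc : ∀ u v, G.coherentClosure.colour u u = G.coherentClosure.colour v v → t u = t v :=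
    fun u v h => (ht u v).2 (SimpleGraph.degree_eq_of_colour_eq hS hA h)
  by_cases hfib : ∀ u v, t u = t v →
      G.coherentClosure.colour u u = G.coherentClosure.colour v v
  · obtain ⟨s, p, α, hα, hquad⟩ := hconn.exists_adjMatrix_quadratic heig
    have hent : ∀ u v, ∑ w, G.adjMatrix ℝ u w * G.adjMatrix ℝ w v - s * G.adjMatrix ℝ u v +
        (if u = v then p else 0) = α u * α v := fun u v => by
      have := congrFun (congrFun hquad u) v
      rw [Matrix.add_apply, Matrix.sub_apply, Matrix.mul_apply, Matrix.smul_apply,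
        Matrix.smul_apply, Matrix.one_apply, Matrix.vecMulVec_apply] at this
      simpa using this
    have hdeg : ∀ u, α u ^ 2 = G.degree u + p := fun u => by
      have := hent u u
      rw [← Matrix.mul_apply, SimpleGraph.adjMatrix_mul_self_apply_self] at this
      simp at this
      rw [sq, this]
    -- Positivity of α lets α² = degree + p determine α from the degree and conversely.
    have hα_eq : ∀ u v, α u = α v ↔ t u = t v := fun u v => by
      rw [← sq_eq_sq₀ (hα u).le (hα v).le, hdeg, hdeg, ht]
      simp
    have hαt : ∀ u, α u = α (g (t u)) := fun u => (hα_eq _ _).2 (hg _).symm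
    refine SimpleGraph.IsEquitable.fourteen_le hS hA (s := s) (p := p) (a := α ∘ g)
      (k := fun i j => (Finset.univ.filter fun w => G.Adj (g i) w ∧ t w = j).card)
      (fun u j => ?_) (fun u v => ?_) hsurj (fun i => hα _) (fun i j hij => ?_) htc
    · have hj : ∀ w, t w = j ↔ G.degree w = G.degree (g j) := fun w => by rw [← ht, hg]
      simp only [hj]
      exact SimpleGraph.card_neighbors_of_degree_eq_of_colour_eq hS hA _
        (hfib _ _ (hg _).symm)
    · rw [hent, hαt u, hαt v]
      rfl
    · have := (hα_eq _ _).1 hij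
      rwa [hg, hg] at this
  · push Not at hfib
    obtain ⟨u, v, huv, hne⟩ := hfib
    -- The four vertices are v and one representative of each cell; u represents its own cell, so
    -- that v is inequivalent to it.
    have h16 := hS.card_sq_le
      (fun x : Option (Fin 3) => x.elim v (Function.update g (t u) u)) (by
        have hsec : ∀ i, t (Function.update g (t u) u i) = i := fun i => by
          by_cases hi : i = t u
          · subst hi
            simp
          · rw [Function.update_of_ne hi, hg]
        have hnone : ∀ i, G.coherentClosure.colour v v ≠
            G.coherentClosure.colour (Function.update g (t u) u i)
              (Function.update g (t u) u i) := fun i hi => by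
          have h1 := htc _ _ hi
          rw [hsec, ← huv] at h1
          subst h1
          rw [Function.update_self] at hi
          exact hne hi.symm
        rintro (_ | i) (_ | j) hij
        · rfl
        · exact absurd hij (hnone j)
        · exact absurd hij.symm (hnone i)
        · have := htc _ _ hij
          simp only [Option.elim] at this
          rw [hsec, hsec] at this
          rw [this])
    simp at h16
    omega
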